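/- Let $n$ be a nonnegative integer. For $z \in \mathbb{C}\setminus\{0\}$ let $\operatorname{Arg} z \in (-\pi,\pi]$ be the principal argument, and put $\operatorname{Arg} 0 = 0$. Let $$\mathcal{C}_n = \Big\{ (z_1,\dots,z_n) \in \mathbb{C}^n : \operatorname{Im} z_j \ge 0 \text{ for } 1\le j\le n, \ \sum_{j=1}^n \operatorname{Arg} z_j \le \tfrac{\pi}{2} \Big\}.$$ (1) If $H$ and $\Gamma$ are positive semi-definite Hermitian complex $n\times n$ matrices with $\operatorname{rank}\Gamma \le 1$, and $z_1,\dots,z_n$ are the eigenvalues of $H_{\mathrm{eff}} = H + i\Gamma$, counted with their algebraic multiplicities and listed in any order, then $(z_1,\dots,z_n) \in \mathcal{C}_n$. (2) Conversely, for every $(z_1,\dots,z_n) \in \mathcal{C}_n$ there exist positive semi-definite Hermitian complex $n\times n$ matrices $H$ and $\Gamma$ with $\operatorname{rank}\Gamma \le 1$ such that $z_1,\dots,z_n$ are the eigenvalues of $H + i\Gamma$, counted with their algebraic multiplicities. -/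

import Mathlib

open scoped ComplexOrder

/-- The tuple `z` lists the eigenvalues of the `n × n` complex matrix `A`, each one repeated
according to its algebraic multiplicity (its multiplicity as a root of the characteristic
polynomial), in some order. -/
def IsEigenvalueTuple {n : ℕ} (A : Matrix (Fin n) (Fin n) ℂ) (z : Fin n → ℂ) : Prop :=
  A.charpoly.roots = Multiset.map z Finset.univ.val

/-- The `n`-tuples of points of the closed upper half-plane whose arguments add up to at most
`π / 2`. Here `Complex.arg` is the principal argument, with values in `(-π, π]` and
`Complex.arg 0 = 0`. -/
def eigenvalueConfigurations (n : ℕ) : Set (Fin n → ℂ) :=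
  {z | (∀ j, 0 ≤ (z j).im) ∧ ∑ j, Complex.arg (z j) ≤ Real.pi / 2}

/-! For Hermitian `M` and Hermitian `Γ` of rank at most one, `det (M + iΓ)` has real part `det M`
(`re_det_add_I_smul`). With `M = t + H` this gives `Re ∏ (t + z j) = det (t + H)`, so `H` is
positive semidefinite exactly when the left side is positive for all `t > 0`. When every `Im z j ≥
0`, that positivity amounts to `∑ arg (z j) ≤ π / 2`: necessity follows the arguments continuously
from `t = ∞`, sufficiency uses that shifting right decreases arguments. For the converse, a
triangular matrix prescribes the spectrum and the same identity shows `H ≥ 0`. -/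

open Matrix in
theorem Matrix.exists_eq_vecMulVec_of_rank_le_one {m n K : Type*} [Fintype n] [DecidableEq n]
    [Finite m] [Field K] {A : Matrix m n K} (h : A.rank ≤ 1) :
    ∃ u v, A = vecMulVec u v := by
  obtain ⟨⟨u, hu⟩, hc⟩ := finrank_le_one_iff.1 h
  choose c hc using fun k : n =>
    hc ⟨A.mulVecLin (Pi.single k 1), LinearMap.mem_range_self _ _⟩
  refine ⟨u, c, ?_⟩
  ext i k
  have := congrFun (congrArg Subtype.val (hc k)) i
  simp only [SetLike.val_smul, Pi.smul_apply, smul_eq_mul, mulVecLin_apply, mulVec_single_one,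
    col_apply] at this
  rw [vecMulVec_apply, mul_comm, this]

-- Matrix determinant lemma: the slope is `det B * (v ⬝ᵥ B⁻¹ *ᵥ u)`.
open Matrix in
theorem Matrix.exists_det_add_smul_vecMulVec {n : Type*} [Fintype n] [DecidableEq n]
    {B : Matrix n n ℂ} (hB : B.det ≠ 0) (u v : n → ℂ) :
    ∃ c, ∀ s : ℂ, (B + s • vecMulVec u v).det = B.det + s * c := by
  refine ⟨B.det * (v ⬝ᵥ B⁻¹ *ᵥ u), fun s => ?_⟩
  have h := det_add_replicateCol_mul_replicateRow (ι := Unit) hB.isUnit (s • u) v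
  have h1 : replicateCol Unit (s • u) * replicateRow Unit v = s • vecMulVec u v := by
    ext i j; simp [mul_apply, vecMulVec_apply, mul_assoc]
  rw [h1] at h
  rw [h, Matrix.mul_assoc, det_unique (n := Unit)]
  have h2 : (replicateRow Unit v * (B⁻¹ * replicateCol Unit (s • u))) default default
      = v ⬝ᵥ B⁻¹ *ᵥ (s • u) := rfl
  rw [Matrix.add_apply (m := Unit), h2, mulVec_smul, dotProduct_smul, smul_eq_mul]
  simp only [one_apply_eq]
  ring

open Matrix in
/-- A rank one perturbation in the anti-Hermitian direction does not change the real part of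
the determinant of a Hermitian matrix. -/
theorem Matrix.IsHermitian.re_det_add_I_smul {n : Type*} [Fintype n] [DecidableEq n]
    {M Γ : Matrix n n ℂ} (hM : M.IsHermitian) (hΓ : Γ.IsHermitian) (hr : Γ.rank ≤ 1) :
    (M + Complex.I • Γ).det.re = M.det.re := by
  obtain ⟨u, v, huv⟩ := exists_eq_vecMulVec_of_rank_le_one hr
  by_cases h0 : M.det = 0 ∧ (M + Complex.I • Γ).det = 0
  · rw [h0.1, h0.2]
  -- Expand about whichever of `M`, `M + iΓ` is invertible.
  have haff : ∃ a c, ∀ s : ℂ, (M + s • Γ).det = a + s * c := by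
    by_cases h1 : M.det = 0
    · obtain ⟨c, hc⟩ := exists_det_add_smul_vecMulVec (fun h2 => h0 ⟨h1, h2⟩) u v
      rw [← huv] at hc
      refine ⟨(M + Complex.I • Γ).det - Complex.I * c, c, fun s => ?_⟩
      rw [show M + s • Γ = M + Complex.I • Γ + (s - Complex.I) • Γ by
        rw [sub_smul]; abel, hc]
      ring
    · obtain ⟨c, hc⟩ := exists_det_add_smul_vecMulVec h1 u v
      exact ⟨_, c, huv ▸ hc⟩
  obtain ⟨a, c, hac⟩ := haff
  have hstar : (M + (-Complex.I) • Γ).det = star (M + Complex.I • Γ).det := by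
    rw [← det_conjTranspose, conjTranspose_add, conjTranspose_smul, hM.eq, hΓ.eq]
    simp
  -- An affine function at `0` is the mean of its values at `±i`, which are conjugate here.
  have h2 : (M + (-Complex.I) • Γ).det + (M + Complex.I • Γ).det = 2 * M.det := by
    have h3 := hac 0
    rw [zero_smul, add_zero] at h3
    rw [hac, hac, h3]; ring
  rw [hstar] at h2
  have := congrArg Complex.re h2
  simp at this
  linarith

theorem Complex.prod_eq_norm_mul_exp_sum_arg {ι : Type*} (s : Finset ι) (w : ι → ℂ) :
    ∏ j ∈ s, w j = (∏ j ∈ s, ‖w j‖ : ℝ) * Complex.exp ((∑ j ∈ s, (w j).arg : ℝ) * Complex.I) := by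
  push_cast
  rw [Finset.sum_mul, Complex.exp_sum, ← Finset.prod_mul_distrib]
  exact Finset.prod_congr rfl fun j _ => (Complex.norm_mul_exp_arg_mul_I _).symm

theorem Complex.re_prod_eq {ι : Type*} (s : Finset ι) (w : ι → ℂ) :
    (∏ j ∈ s, w j).re = (∏ j ∈ s, ‖w j‖) * Real.cos (∑ j ∈ s, (w j).arg) := by
  rw [Complex.prod_eq_norm_mul_exp_sum_arg, Complex.re_ofReal_mul, Complex.exp_ofReal_mul_I_re]

theorem IsEigenvalueTuple.charpoly_eq {n : ℕ} {A : Matrix (Fin n) (Fin n) ℂ} {z : Fin n → ℂ}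
    (h : IsEigenvalueTuple A z) :
    A.charpoly = ∏ j, (Polynomial.X - Polynomial.C (z j)) := by
  rw [(IsAlgClosed.splits A.charpoly).eq_prod_roots_of_monic A.charpoly_monic, h,
    Multiset.map_map]
  rfl

theorem isEigenvalueTuple_of_charpoly_eq {n : ℕ} {A : Matrix (Fin n) (Fin n) ℂ} {z : Fin n → ℂ}
    (h : A.charpoly = ∏ j, (Polynomial.X - Polynomial.C (z j))) : IsEigenvalueTuple A z := by
  rw [IsEigenvalueTuple, h]
  exact (Polynomial.roots_multiset_prod_X_sub_C (Multiset.map z Finset.univ.val)) ▸ by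
    rw [Multiset.map_map]; rfl

theorem IsEigenvalueTuple.det_smul_one_add {n : ℕ} {A : Matrix (Fin n) (Fin n) ℂ}
    {z : Fin n → ℂ} (h : IsEigenvalueTuple A z) (t : ℂ) :
    (t • (1 : Matrix (Fin n) (Fin n) ℂ) + A).det = ∏ j, (t + z j) := by
  have h1 := A.eval_charpoly (-t)
  rw [h.charpoly_eq, Polynomial.eval_prod] at h1
  have h2 : Matrix.scalar (Fin n) (-t) - A = -(t • (1 : Matrix (Fin n) (Fin n) ℂ) + A) := by
    rw [Matrix.scalar_apply, ← Matrix.smul_one_eq_diagonal, neg_smul]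
    abel
  have h3 : ∏ j, (-t - z j) = (-1) ^ n * ∏ j, (t + z j) := by
    rw [show (-1 : ℂ) ^ n = ∏ _j : Fin n, (-1 : ℂ) by simp, ← Finset.prod_mul_distrib]
    exact Finset.prod_congr rfl fun j _ => by ring
  simp only [Polynomial.eval_sub, Polynomial.eval_X, Polynomial.eval_C] at h1
  rw [h2, Matrix.det_neg, h3, Fintype.card_fin] at h1
  exact (mul_left_cancel₀ (pow_ne_zero n (by norm_num)) h1).symm

open Matrix in
theorem IsEigenvalueTuple.im_nonneg {n : ℕ} {H Γ : Matrix (Fin n) (Fin n) ℂ}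
    (hH : H.IsHermitian) (hΓ : Γ.PosSemidef) {z : Fin n → ℂ}
    (h : IsEigenvalueTuple (H + Complex.I • Γ) z) (j : Fin n) : 0 ≤ (z j).im := by
  have hdet : ((-z j) • (1 : Matrix (Fin n) (Fin n) ℂ) + (H + Complex.I • Γ)).det = 0 := by
    rw [h.det_smul_one_add]
    exact Finset.prod_eq_zero (Finset.mem_univ j) (by simp)
  obtain ⟨v, hv, hv0⟩ := exists_mulVec_eq_zero_iff.2 hdet
  have h1 : star v ⬝ᵥ H *ᵥ v + Complex.I * (star v ⬝ᵥ Γ *ᵥ v) = z j * (star v ⬝ᵥ v) := by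
    have := congrArg (fun x => star v ⬝ᵥ x) hv0
    simp only [add_mulVec, smul_mulVec, one_mulVec, dotProduct_add, dotProduct_smul,
      smul_eq_mul, dotProduct_zero] at this
    linear_combination this
  have hHim : (star v ⬝ᵥ H *ᵥ v).im = 0 := hH.im_star_dotProduct_mulVec_self v
  have hG := Complex.nonneg_iff.1 (hΓ.dotProduct_mulVec_nonneg v)
  have hvp := Complex.pos_iff.1 (dotProduct_star_self_pos_iff.2 hv)
  have h2 := congrArg Complex.im h1
  simp only [Complex.add_im, Complex.mul_im, Complex.I_re, Complex.I_im, hHim] at h2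
  rw [← hvp.2] at h2
  nlinarith [hvp.1, hG.1]

open Filter Topology in
/-- If the real part of `∏ (1 + s z_j)` stays positive along the ray `s ≥ 0`, the sum of the
principal arguments of the `z_j` cannot exceed `π / 2`. -/
theorem Complex.sum_arg_le_of_re_prod_pos {ι : Type*} [Fintype ι] {z : ι → ℂ}
    (hpos : ∀ s : ℝ, 0 ≤ s → 0 < (∏ j, (1 + s * z j)).re) :
    ∑ j, (z j).arg ≤ Real.pi / 2 := by
  have hne : ∀ s : ℝ, 0 ≤ s → ∀ j, 1 + s * z j ≠ 0 := fun s hs j h0 => by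
    have := hpos s hs
    rw [Finset.prod_eq_zero (Finset.mem_univ j) h0] at this
    simp at this
  -- A negative real `z j` would kill its factor at `s = -1 / z j`.
  have hslit0 : ∀ j, z j = 0 ∨ z j ∈ Complex.slitPlane := fun j => by
    by_contra! hcon
    obtain ⟨h0, h1⟩ := hcon
    rw [Complex.mem_slitPlane_iff] at h1
    push Not at h1
    have hre : (z j).re ≠ 0 := fun h => h0 (Complex.ext h h1.2)
    have hlt : (z j).re < 0 := lt_of_le_of_ne h1.1 hre
    refine hne (-(z j).re)⁻¹ (by rw [inv_nonneg]; linarith) j ?_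
    apply Complex.ext
    · simp [h1.2]; field_simp; ring
    · simp [h1.2]
  have hslit : ∀ s : ℝ, 0 ≤ s → ∀ j, 1 + s * z j ∈ Complex.slitPlane := fun s hs j => by
    rw [Complex.mem_slitPlane_iff]
    simp only [Complex.add_re, Complex.one_re, Complex.re_ofReal_mul, Complex.add_im,
      Complex.one_im, Complex.im_ofReal_mul, zero_add]
    rcases hs.eq_or_lt with rfl | hs'
    · left; simp
    rcases hslit0 j with h | h
    · left; simp [h]
    rcases Complex.mem_slitPlane_iff.1 h with h | h
    · left; positivity
    · right; exact mul_ne_zero hs'.ne' h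
  set θ : ℝ → ℝ := fun s => ∑ j, (1 + s * z j).arg with hθ
  have hcont : ContinuousOn θ (Set.Ici 0) := by
    refine continuousOn_finsetSum _ fun j _ s hs => ?_
    have h1 : ContinuousAt (fun s : ℝ => 1 + (s : ℂ) * z j) s := by fun_prop
    exact (ContinuousAt.comp (f := fun s : ℝ => 1 + (s : ℂ) * z j)
      (Complex.continuousAt_arg (hslit s hs j)) h1).continuousWithinAt
  -- `θ` starts at `0` and cannot cross `π / 2`, where the cosine, hence the real part, vanishes.
  have hlt : ∀ s : ℝ, 0 ≤ s → θ s < Real.pi / 2 := fun s hs => by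
    by_contra! hcon
    have h0 : θ 0 = 0 := by simp [hθ]
    obtain ⟨x, hx, hxe⟩ := intermediate_value_Icc hs (hcont.mono Set.Icc_subset_Ici_self)
      (show Real.pi / 2 ∈ Set.Icc (θ 0) (θ s) from ⟨by rw [h0]; positivity, hcon⟩)
    have := hpos x hx.1
    rw [Complex.re_prod_eq, show ∑ j, (1 + (x : ℂ) * z j).arg = θ x from rfl, hxe,
      Real.cos_pi_div_two, mul_zero] at this
    exact lt_irrefl _ this
  have hlim : Tendsto θ atTop (𝓝 (∑ j, (z j).arg)) := by
    refine tendsto_finsetSum _ fun j _ => ?_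
    rcases hslit0 j with h | h
    -- The convention `arg 0 = 0` agrees with the constant term `arg 1 = 0`.
    · simp [h]
    have h1 : Tendsto (fun s : ℝ => (((s⁻¹ : ℝ) : ℂ) + z j).arg) atTop (𝓝 (z j).arg) := by
      have h2 : Tendsto (fun s : ℝ => ((s⁻¹ : ℝ) : ℂ) + z j) atTop (𝓝 (z j)) := by
        have h3 := ((Complex.continuous_ofReal.tendsto 0).comp tendsto_inv_atTop_zero).add_const
          (z j)
        simpa [Function.comp_def] using h3
      exact (Complex.continuousAt_arg h).tendsto.comp h2
    refine h1.congr' ?_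
    filter_upwards [eventually_gt_atTop 0] with s hs
    rw [← Complex.arg_real_mul _ hs, mul_add, ← Complex.ofReal_mul, mul_inv_cancel₀ hs.ne',
      Complex.ofReal_one]
  exact le_of_tendsto hlim ((eventually_ge_atTop 0).mono fun s hs => (hlt s hs).le)

/-- In the right half-plane the argument is `arcsin (im / ‖·‖)`; the shift keeps `im` and enlarges
the norm. -/
theorem Complex.arg_ofReal_add_lt {z : ℂ} (hre : 0 ≤ z.re) (him : 0 < z.im) {t : ℝ}
    (ht : 0 < t) : ((t : ℂ) + z).arg < z.arg := by
  have hre' : 0 ≤ ((t : ℂ) + z).re := by simp; linarith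
  have hz : 0 < ‖z‖ := norm_pos_iff.2 fun h => by simp [h] at him
  rw [Complex.arg_of_re_nonneg hre, Complex.arg_of_re_nonneg hre']
  have hnorm : ‖z‖ < ‖(t : ℂ) + z‖ := by
    rw [Complex.norm_def, Complex.norm_def]
    apply Real.sqrt_lt_sqrt (Complex.normSq_nonneg _)
    rw [Complex.normSq_apply, Complex.normSq_apply]
    simp
    nlinarith
  apply Real.arcsin_lt_arcsin
  · have : 0 ≤ ((t : ℂ) + z).im / ‖(t : ℂ) + z‖ := by
      apply div_nonneg _ (norm_nonneg _); simp [him.le]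
    linarith
  · simp only [Complex.add_im, Complex.ofReal_im, zero_add]
    exact div_lt_div_of_pos_left him hz hnorm
  · exact (div_le_one hz).2 (Complex.im_le_norm z)

theorem Complex.re_prod_ofReal_add_pos {ι : Type*} [Fintype ι] {z : ι → ℂ}
    (him : ∀ j, 0 ≤ (z j).im) (hsum : ∑ j, (z j).arg ≤ Real.pi / 2) {t : ℝ} (ht : 0 < t) :
    0 < (∏ j, ((t : ℂ) + z j)).re := by
  have harg : ∀ j, 0 ≤ (z j).arg := fun j => Complex.arg_nonneg_iff.2 (him j)
  have hre : ∀ j, 0 ≤ (z j).re := fun j => by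
    have h1 : (z j).arg ≤ Real.pi / 2 :=
      (Finset.single_le_sum (fun i _ => harg i) (Finset.mem_univ j)).trans hsum
    have h2 : |(z j).arg| ≤ Real.pi / 2 := by rwa [abs_of_nonneg (harg j)]
    exact Complex.abs_arg_le_pi_div_two_iff.1 h2
  have hreal : ∀ j, (z j).im = 0 → ((t : ℂ) + z j).arg = 0 := fun j hj => by
    rw [Complex.arg_eq_zero_iff]
    exact ⟨by have := hre j; simp; linarith, by simp [hj]⟩
  have hle : ∀ j, ((t : ℂ) + z j).arg ≤ (z j).arg := fun j => by
    rcases (him j).eq_or_lt with h | h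
    · rw [hreal j h.symm]; exact harg j
    · exact (Complex.arg_ofReal_add_lt (hre j) h ht).le
  have hlt : ∑ j, ((t : ℂ) + z j).arg < Real.pi / 2 := by
    by_cases h : ∃ j, 0 < (z j).im
    · obtain ⟨j, hj⟩ := h
      exact (Finset.sum_lt_sum (fun i _ => hle i) ⟨j, Finset.mem_univ j,
        Complex.arg_ofReal_add_lt (hre j) hj ht⟩).trans_le hsum
    · push Not at h
      rw [Finset.sum_eq_zero fun j _ => hreal j (le_antisymm (h j) (him j))]
      positivity
  have hnn : 0 ≤ ∑ j, ((t : ℂ) + z j).arg :=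
    Finset.sum_nonneg fun j _ => Complex.arg_nonneg_iff.2 (by simpa using him j)
  rw [Complex.re_prod_eq]
  refine mul_pos (Finset.prod_pos fun j _ => norm_pos_iff.2 fun h => ?_)
    (Real.cos_pos_of_mem_Ioo ⟨by linarith [Real.pi_pos], hlt⟩)
  have h1 := congrArg Complex.re h
  simp at h1
  linarith [hre j]

-- A negative eigenvalue `μ` would make `t + H` singular at `t = -μ`.
open Matrix in
theorem Matrix.IsHermitian.posSemidef_of_re_det_pos {n : Type*} [Fintype n] [DecidableEq n]
    {H : Matrix n n ℂ} (hH : H.IsHermitian)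
    (h : ∀ t : ℝ, 0 < t → 0 < ((t : ℂ) • (1 : Matrix n n ℂ) + H).det.re) : H.PosSemidef := by
  rw [hH.posSemidef_iff_eigenvalues_nonneg]
  intro i
  by_contra hcon
  have hlt : hH.eigenvalues i < 0 := not_le.1 hcon
  have h1 := h (-hH.eigenvalues i) (by linarith)
  have h2 : (((-hH.eigenvalues i : ℝ) : ℂ) • (1 : Matrix n n ℂ) + H).det = 0 := by
    refine exists_mulVec_eq_zero_iff.1 ⟨⇑(hH.eigenvectorBasis i), ?_, ?_⟩
    · intro h0
      exact hH.eigenvectorBasis.orthonormal.ne_zero i (by ext k; exact congrFun h0 k)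
    · rw [add_mulVec, hH.mulVec_eigenvectorBasis, smul_mulVec, one_mulVec]
      ext k
      simp
  rw [h2] at h1
  simp at h1

open Matrix in
/-- Every configuration is realized by an upper triangular matrix whose anti-Hermitian part has
rank one. -/
theorem exists_isEigenvalueTuple_of_mem_eigenvalueConfigurations {n : ℕ} {z : Fin n → ℂ}
    (hz : z ∈ eigenvalueConfigurations n) :
    ∃ H Γ : Matrix (Fin n) (Fin n) ℂ, H.PosSemidef ∧ Γ.PosSemidef ∧ Γ.rank ≤ 1 ∧
      IsEigenvalueTuple (H + Complex.I • Γ) z := by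
  obtain ⟨him, hsum⟩ := hz
  set w : Fin n → ℂ := fun j => (Real.sqrt (z j).im : ℂ) with hw
  have hstar : star w = w := by ext j; simp [hw]
  have hww : ∀ j, w j * w j = ((z j).im : ℂ) := fun j => by
    rw [hw, ← Complex.ofReal_mul, Real.mul_self_sqrt (him j)]
  set Γ : Matrix (Fin n) (Fin n) ℂ := vecMulVec w (star w) with hΓdef
  -- Signs are chosen so that `H` cancels `iΓ` below the diagonal; on it, `w j * w j = Im (z j)`
  -- completes `z j`.
  set H : Matrix (Fin n) (Fin n) ℂ := Matrix.of fun j k =>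
    if j = k then ((z j).re : ℂ) else
      if j < k then Complex.I * (w j * w k) else -(Complex.I * (w j * w k)) with hHdef
  have hΓ : Γ.PosSemidef := posSemidef_vecMulVec_self_star w
  have hr : Γ.rank ≤ 1 := rank_vecMulVec_le _ _
  have hwc : ∀ j, (starRingEnd ℂ) (w j) = w j := fun j => by simp [hw]
  have hH : H.IsHermitian := by
    ext j k
    rw [conjTranspose_apply, hHdef]
    rcases lt_trichotomy j k with h | rfl | h
    · simp [h.ne, h.ne', h, h.not_gt, hwc, mul_comm]
    · simp
    · simp [h.ne, h.ne', h, h.not_gt, hwc, mul_comm]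
  have htri : (H + Complex.I • Γ).IsUpperTriangular := by
    intro j k hjk
    have hjk' : k < j := hjk
    simp [hHdef, hΓdef, Matrix.add_apply, Matrix.smul_apply, hstar, vecMulVec_apply, hjk'.ne',
      hjk'.not_gt]
  have hdiag : ∀ j, (H + Complex.I • Γ) j j = z j := fun j => by
    simp only [hHdef, hΓdef, hstar, Matrix.add_apply, Matrix.smul_apply,
      Matrix.of_apply, vecMulVec_apply, hww, smul_eq_mul,
      if_true]
    rw [mul_comm, Complex.re_add_im]
  have heig : IsEigenvalueTuple (H + Complex.I • Γ) z := by
    apply isEigenvalueTuple_of_charpoly_eq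
    rw [charpoly_of_isUpperTriangular _ htri]
    simp only [hdiag]
  refine ⟨H, Γ, hH.posSemidef_of_re_det_pos fun t ht => ?_, hΓ, hr, heig⟩
  have hM : ((t : ℂ) • (1 : Matrix (Fin n) (Fin n) ℂ) + H).IsHermitian := by
    refine IsHermitian.add ?_ hH
    rw [IsHermitian, conjTranspose_smul, conjTranspose_one]
    simp
  rw [← hM.re_det_add_I_smul hΓ.isHermitian hr, add_assoc, heig.det_smul_one_add]
  exact Complex.re_prod_ofReal_add_pos him hsum ht

open Matrix in
theorem IsEigenvalueTuple.mem_eigenvalueConfigurations {n : ℕ}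
    {H Γ : Matrix (Fin n) (Fin n) ℂ} (hH : H.PosSemidef) (hΓ : Γ.PosSemidef) (hr : Γ.rank ≤ 1)
    {z : Fin n → ℂ} (h : IsEigenvalueTuple (H + Complex.I • Γ) z) :
    z ∈ eigenvalueConfigurations n := by
  have him := h.im_nonneg hH.isHermitian hΓ
  -- Here `s = 1 / t`, so `s = 0` stands for `t = ∞`.
  refine ⟨him, Complex.sum_arg_le_of_re_prod_pos fun s hs => ?_⟩
  rcases hs.eq_or_lt with rfl | hs
  · simp
  have ht : (0 : ℂ) < ((s⁻¹ : ℝ) : ℂ) := by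
    rw [← Complex.ofReal_zero, Complex.real_lt_real]; positivity
  have hM : (((s⁻¹ : ℝ) : ℂ) • (1 : Matrix (Fin n) (Fin n) ℂ) + H).PosDef :=
    (PosDef.one.smul ht).add_posSemidef hH
  have h1 := hM.isHermitian.re_det_add_I_smul hΓ.isHermitian hr
  rw [add_assoc, h.det_smul_one_add] at h1
  have h2 := (Complex.pos_iff.1 hM.det_pos).1
  rw [← h1] at h2
  have h3 : ∏ j, (1 + (s : ℂ) * z j) = ((s ^ n : ℝ) : ℂ) * ∏ j, (((s⁻¹ : ℝ) : ℂ) + z j) := by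
    rw [show ((s ^ n : ℝ) : ℂ) = ∏ _j : Fin n, (s : ℂ) by simp, ← Finset.prod_mul_distrib]
    refine Finset.prod_congr rfl fun j _ => ?_
    rw [mul_add, ← Complex.ofReal_mul, mul_inv_cancel₀ hs.ne', Complex.ofReal_one]
  rw [h3, Complex.re_ofReal_mul]
  positivity

theorem corollary4p4 (n : ℕ) :
    (∀ H Γ : Matrix (Fin n) (Fin n) ℂ, H.PosSemidef → Γ.PosSemidef → Γ.rank ≤ 1 →
      ∀ z : Fin n → ℂ, IsEigenvalueTuple (H + Complex.I • Γ) z →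
        z ∈ eigenvalueConfigurations n) ∧
    (∀ z ∈ eigenvalueConfigurations n,
      ∃ H Γ : Matrix (Fin n) (Fin n) ℂ, H.PosSemidef ∧ Γ.PosSemidef ∧ Γ.rank ≤ 1 ∧
        IsEigenvalueTuple (H + Complex.I • Γ) z) :=
  ⟨fun _ _ hH hΓ hr _ h => h.mem_eigenvalueConfigurations hH hΓ hr,
    fun _ hz => exists_isEigenvalueTuple_of_mem_eigenvalueConfigurations hz⟩
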